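/- Let $\mathbb S^1=\mathbb R/2\pi\mathbb Z$, let $\hat f_j=\frac1{2\pi}\int_0^{2\pi}f(x)e^{-ijx}\,dx$, and write $\|f\|_{H^s}^2=\sum_{k\in\mathbb Z}(1+k^2)^s|\hat f_k|^2$ for the Sobolev norm on $\mathbb S^1$. For $\alpha\ge1$ and $B>0$ let $\|f\|_{\mathcal G_{\alpha},B}$ denote the best constant $K\in[0,\infty]$ such that $|\hat f_j|\le K e^{-B|j|^{1/\alpha}}$ for all $j\in\mathbb Z$. Theorem. Let $\alpha\ge 1$. There are constants $B>0$ and $C_\alpha>0$, depending only on $\alpha$, such that for every $s>0$ there exist a sequence of real potentials $V_q:\mathbb R\times\mathbb S^1\to\mathbb R$ ($q\in\mathbb N$), a sequence of initial data $u_0^q:\mathbb S^1\to\mathbb C$, a sequence of times $T_q>1$ with $T_q\to+\infty$ as $q\to+\infty$, and a constant $C_{\alpha,s}>0$ depending only on $\alpha$ and $s$, with the following properties for every $q$: 1. $V_q$ is $C^\infty$ on $\mathbb R\times\mathbb S^1$, $V_q(t,\cdot)$ is real analytic on $\mathbb S^1$ for every $t$, and $\|V_q(t,\cdot)\|_{\mathcal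 G_\alpha,B}\le C_\alpha$ for all $t\in[0,T_q]$. 2. $\|u_0^q\|_{H^s}=1$. 3. The Cauchy problem $i\partial_tu+\partial_x^2u+V_q(t,x)u=0$ on $\mathbb R\times\mathbb S^1$, $u(0,\cdot)=u_0^q$, has a unique classical ($C^2$) solution $u^q$, and $u^q(t,\cdot)$ is real analytic on $\mathbb S^1$ for every $t\in[0,T_q]$. 4. $\|u^q(T_q)\|_{H^s}\ge C_{\alpha,s}\,(\ln T_q)^{s\alpha}$. -/

import Mathlib

open scoped ContDiff ENNReal

noncomputable section

/-- The length `2π` of the circle is positive. -/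
instance factTwoPiPos : Fact (0 < 2 * Real.pi) := ⟨Real.two_pi_pos⟩

/-- The circle `ℝ / 2πℤ`. The `j`-th Fourier coefficient of `f : S1 → ℂ`, i.e.
`(2π)⁻¹ ∫₀^{2π} f(x) e^{-ijx} dx`, is Mathlib's `fourierCoeff f j`. -/
abbrev S1 : Type := AddCircle (2 * Real.pi)

/-- The (inhomogeneous) Sobolev norm of `H^s(S1)`:
`‖f‖² = ∑_k (1 + k²)^s |f̂_k|²`. The infinite sum is `0` if it diverges. -/
def sobolevNorm (s : ℝ) (f : S1 → ℂ) : ℝ :=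
  Real.sqrt (∑' k : ℤ, (1 + (k : ℝ) ^ 2) ^ s * ‖fourierCoeff f k‖ ^ 2)

/-- The Gevrey semi-norm of order `α` and radius `B`: the best constant `K ∈ [0, ∞]` such that
`|f̂_j| ≤ K exp (-B |j|^{1/α})` for all integers `j`. -/
def gevreySeminorm (α B : ℝ) (f : S1 → ℂ) : ℝ≥0∞ :=
  ⨆ j : ℤ, ENNReal.ofReal (‖fourierCoeff f j‖ * Real.exp (B * |(j : ℝ)| ^ (1 / α)))

/-- `f` is real analytic on the circle. -/
def IsAnalyticOnCircle {E : Type*} [NormedAddCommGroup E] [NormedSpace ℝ E] (f : S1 → E) : Prop :=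
  AnalyticOnNhd ℝ (fun x : ℝ => f (x : S1)) Set.univ

/-- `f` is of class `C^n` on `ℝ × S1`. -/
def IsContDiffOnCylinder {E : Type*} [NormedAddCommGroup E] [NormedSpace ℝ E] (n : WithTop ℕ∞)
    (f : ℝ → S1 → E) : Prop :=
  ContDiff ℝ n (fun p : ℝ × ℝ => f p.1 (p.2 : S1))

/-- `u` is a classical solution on `ℝ × S1` of the Cauchy problem
`i ∂ₜu + ∂ₓ²u + V(t,x) u = 0`, `u(0) = u₀`. -/
structure IsSchrodingerSolution (V : ℝ → S1 → ℝ) (u₀ : S1 → ℂ) (u : ℝ → S1 → ℂ) : Prop where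
  contDiff : IsContDiffOnCylinder 2 u
  initial : u 0 = u₀
  equation : ∀ t x : ℝ,
    Complex.I * deriv (fun τ : ℝ => u τ (x : S1)) t
      + iteratedDeriv 2 (fun y : ℝ => u t (y : S1)) x
      + (V t (x : S1) : ℂ) * u t (x : S1) = 0

end

noncomputable section

open MeasureTheory AddCircle
open scoped Nat ComplexConjugate

/-! The example is explicit. Put `z = Qx - Q²t` and `X = exp (β cos z)`. For the travelling
Whittaker–Hill potential, the functions `exp (±iβQ²t) X (1 ± e^{iz})` both solve the equation. Half
their sum is `beatingSolution` (up to the factor `A`): it equals `X`, concentrated near mode `0`, at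
time `0`, and has modulus `|X|` with all frequencies shifted by `Q` at the half period `T = π /
(2βQ²)`.

Choose `βQ² = ε = exp (-Q^{1/α})`. The potential has only the modes `0, ±Q, ±2Q`, with amplitudes
small enough for a Gevrey bound with `B = 1`, uniform in `Q`
(`gevreySeminorm_whittakerHillPotential_le`). Then `T = (π/2) exp (Q^{1/α})`, so `Q` is comparable
to `(ln T)^α`.

The profile `X` has Sobolev norm bounded above and below independently of `Q`
(`weight_mul_fourierCoeff_waveProfile_le`, `one_le_norm_fourierCoeff_waveProfile_zero`), while its
shift by `Q` has norm at least `Q^s`. Uniqueness is `L²` conservation, which uses that the potential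
is real. -/

/-! ### Fourier coefficients of absolutely convergent mode series. -/

/-- Termwise integration by dominated convergence. Since `κ` need not be injective, double series
with repeated frequencies are covered. -/
theorem fourierCoeff_hasSum_of_hasSum_fourier {ι : Type*} [Countable ι] {c : ι → ℂ} {κ : ι → ℤ}
    {f : S1 → ℂ} (hc : Summable fun i => ‖c i‖)
    (hf : ∀ x, HasSum (fun i => c i * fourier (κ i) x) (f x)) (k : ℤ) :
    HasSum (fun i => if κ i = k then c i else 0) (fourierCoeff f k) := by
  have h := hasSum_integral_of_dominated_convergence (μ := (haarAddCircle : Measure S1))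
    (F := fun i x => fourier (-k) x • (c i * fourier (κ i) x))
    (f := fun x => fourier (-k) x • f x) (fun i _ => ‖c i‖)
    (fun i => (by fun_prop : Continuous fun x : S1 =>
      fourier (-k) x • (c i * fourier (κ i) x)).aestronglyMeasurable)
    (fun i => Filter.Eventually.of_forall fun x => by
      simp only [fourier_apply, smul_eq_mul, norm_mul, Circle.norm_coe, one_mul, mul_one, le_refl])
    (Filter.Eventually.of_forall fun _ => hc) (integrable_const _)
    (Filter.Eventually.of_forall fun x => (hf x).const_smul _)
  have e : ∀ i, (if κ i = k then c i else 0) = fourierCoeff (fun x : S1 => c i * fourier (κ i) x) k := by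
    intro i
    have h2 : fourierCoeff (fun x : S1 => fourier (κ i) x) k = _ :=
      congrFun (fourierCoeff_fourier (T := 2 * Real.pi) (κ i)) k
    rw [fourierCoeff.const_mul, h2]
    by_cases hk : κ i = k
    · simp [hk]
    · simp [hk, Ne.symm hk]
  rw [funext e]
  exact h

theorem weight_mul_norm_fourierCoeff_le {ι : Type*} [Countable ι] {c : ι → ℂ} {κ : ι → ℤ}
    {f : S1 → ℂ} (hc : Summable fun i => ‖c i‖)
    (hf : ∀ x, HasSum (fun i => c i * fourier (κ i) x) (f x)) {w : ℤ → ℝ} (hw : ∀ k, 0 ≤ w k)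
    {b : ι → ℝ} {M : ℝ} (hb : ∀ i, w (κ i) * ‖c i‖ ≤ b i) (hM : HasSum b M) (k : ℤ) :
    w k * ‖fourierCoeff f k‖ ≤ M := by
  have h := fourierCoeff_hasSum_of_hasSum_fourier hc hf k
  have h1 := h.mul_left (w k : ℂ)
  have h2 : w k * ‖fourierCoeff f k‖ = ‖(w k : ℂ) * fourierCoeff f k‖ := by
    rw [norm_mul, Complex.norm_real, Real.norm_of_nonneg (hw k)]
  rw [h2, ← h1.tsum_eq]
  refine tsum_of_norm_bounded hM fun i => ?_
  split_ifs with hk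
  · rw [norm_mul, Complex.norm_real, Real.norm_of_nonneg (hw k), ← hk]
    exact hb i
  · simpa using (mul_nonneg (hw _) (norm_nonneg _)).trans (hb i)

theorem fourierCoeff_fourier_mul (n k : ℤ) (f : S1 → ℂ) :
    fourierCoeff (fun x => fourier n x * f x) k = fourierCoeff f (k - n) := by
  unfold fourierCoeff
  congr 1
  ext x
  rw [show -(k - n) = -k + n by ring, fourier_add]
  simp [mul_assoc]

/-! ### Sobolev norms from pointwise coefficient decay. -/

theorem summable_int_one_add_abs_sq_inv : Summable fun k : ℤ => ((1 + |(k : ℝ)|) ^ 2)⁻¹ := by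
  have h : Summable fun n : ℕ => ((1 + (n : ℝ)) ^ 2)⁻¹ := by
    have := (summable_nat_add_iff 1).mpr (Real.summable_nat_pow_inv.mpr (by norm_num : 1 < 2))
    simpa [add_comm] using this
  refine Summable.of_nat_of_neg ?_ ?_ <;> simpa using h

/-- One extra power of `1 + |k|` in the hypothesis becomes, after squaring, a summable factor. -/
theorem sobolev_term_le {s M : ℝ} (hs : 0 < s) {f : S1 → ℂ}
    (hM : ∀ k : ℤ, (1 + |(k : ℝ)|) ^ (s + 1) * ‖fourierCoeff f k‖ ≤ M) (k : ℤ) :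
    (1 + (k : ℝ) ^ 2) ^ s * ‖fourierCoeff f k‖ ^ 2 ≤ M ^ 2 * ((1 + |(k : ℝ)|) ^ 2)⁻¹ := by
  have hp : 0 < 1 + |(k : ℝ)| := by positivity
  rw [← div_eq_mul_inv, le_div_iff₀ (by positivity)]
  have h1 : (1 + (k : ℝ) ^ 2) ^ s ≤ ((1 + |(k : ℝ)|) ^ s) ^ 2 := by
    rw [← Real.rpow_natCast ((1 + |(k : ℝ)|) ^ s), ← Real.rpow_mul hp.le, mul_comm s,
      Real.rpow_mul hp.le]
    refine Real.rpow_le_rpow (by positivity) ?_ hs.le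
    norm_num
    nlinarith [abs_nonneg (k : ℝ), sq_abs (k : ℝ)]
  have h2 := hM k
  rw [Real.rpow_add hp, Real.rpow_one] at h2
  calc _ ≤ ((1 + |(k : ℝ)|) ^ s) ^ 2 * ‖fourierCoeff f k‖ ^ 2 * (1 + |(k : ℝ)|) ^ 2 := by gcongr
    _ = ((1 + |(k : ℝ)|) ^ s * (1 + |(k : ℝ)|) * ‖fourierCoeff f k‖) ^ 2 := by ring
    _ ≤ M ^ 2 := by gcongr

theorem sobolev_summable {s M : ℝ} (hs : 0 < s) {f : S1 → ℂ}
    (hM : ∀ k : ℤ, (1 + |(k : ℝ)|) ^ (s + 1) * ‖fourierCoeff f k‖ ≤ M) :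
    Summable fun k : ℤ => (1 + (k : ℝ) ^ 2) ^ s * ‖fourierCoeff f k‖ ^ 2 :=
  .of_nonneg_of_le (fun _ => by positivity) (sobolev_term_le hs hM)
    (summable_int_one_add_abs_sq_inv.mul_left _)

theorem sobolevNorm_le {s M : ℝ} (hs : 0 < s) {f : S1 → ℂ}
    (hM : ∀ k : ℤ, (1 + |(k : ℝ)|) ^ (s + 1) * ‖fourierCoeff f k‖ ≤ M) :
    sobolevNorm s f ≤ M * √(∑' k : ℤ, ((1 + |(k : ℝ)|) ^ 2)⁻¹) := by
  have hM0 : 0 ≤ M := le_trans (by positivity) (hM 0)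
  rw [sobolevNorm, ← Real.sqrt_sq hM0, ← Real.sqrt_mul (sq_nonneg _), ← tsum_mul_left]
  exact Real.sqrt_le_sqrt ((sobolev_summable hs hM).tsum_le_tsum (sobolev_term_le hs hM)
    (summable_int_one_add_abs_sq_inv.mul_left _))

/-- The decay hypothesis only excludes divergence, in which case the sum defining `sobolevNorm`
would be `0`. -/
theorem le_sobolevNorm {s M : ℝ} (hs : 0 < s) {f : S1 → ℂ}
    (hM : ∀ k : ℤ, (1 + |(k : ℝ)|) ^ (s + 1) * ‖fourierCoeff f k‖ ≤ M) (k : ℤ) :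
    √((1 + (k : ℝ) ^ 2) ^ s) * ‖fourierCoeff f k‖ ≤ sobolevNorm s f := by
  refine Real.le_sqrt_of_sq_le (le_trans (le_of_eq ?_) ((sobolev_summable hs hM).le_tsum k
    fun _ _ => by positivity))
  rw [mul_pow, Real.sq_sqrt (by positivity)]

theorem sobolevNorm_const_mul (s : ℝ) (a : ℂ) (f : S1 → ℂ) :
    sobolevNorm s (fun x => a * f x) = ‖a‖ * sobolevNorm s f := by
  unfold sobolevNorm
  simp_rw [fourierCoeff.const_mul, norm_mul, mul_pow, mul_left_comm _ (‖a‖ ^ 2)]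
  rw [tsum_mul_left, Real.sqrt_mul (sq_nonneg _), Real.sqrt_sq (norm_nonneg _)]

/-! ### Uniqueness of classical solutions. -/

theorem hasDerivAt_slice_fst {F : ℝ × ℝ → ℂ} (hF : Differentiable ℝ F) (t x : ℝ) :
    HasDerivAt (fun τ => F (τ, x)) (fderiv ℝ F (t, x) (1, 0)) t :=
  (hF (t, x)).hasFDerivAt.comp_hasDerivAt t ((hasDerivAt_id t).prodMk (hasDerivAt_const t x))

theorem hasDerivAt_slice_snd {F : ℝ × ℝ → ℂ} (hF : Differentiable ℝ F) (t x : ℝ) :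
    HasDerivAt (fun y => F (t, y)) (fderiv ℝ F (t, x) (0, 1)) x :=
  (hF (t, x)).hasFDerivAt.comp_hasDerivAt x ((hasDerivAt_const x t).prodMk (hasDerivAt_id x))

theorem contDiff_one_fderiv_apply {F : ℝ × ℝ → ℂ} (hF : ContDiff ℝ 2 F) (v : ℝ × ℝ) :
    ContDiff ℝ 1 (fun p => fderiv ℝ F p v) :=
  (hF.fderiv_right (by norm_num)).clm_apply contDiff_const

theorem IsSchrodingerSolution.equation_fderiv {V : ℝ → S1 → ℝ} {u₀ : S1 → ℂ} {u : ℝ → S1 → ℂ}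
    (hu : IsSchrodingerSolution V u₀ u) (t x : ℝ) :
    Complex.I * fderiv ℝ (fun p : ℝ × ℝ => u p.1 (p.2 : S1)) (t, x) (1, 0)
      + fderiv ℝ (fun q => fderiv ℝ (fun p : ℝ × ℝ => u p.1 (p.2 : S1)) q (0, 1)) (t, x) (0, 1)
      + (V t (x : S1) : ℂ) * u t (x : S1) = 0 := by
  have hC : ContDiff ℝ 2 (fun p : ℝ × ℝ => u p.1 (p.2 : S1)) := hu.contDiff
  have hD := hC.differentiable (by norm_num)
  have h1 := (hasDerivAt_slice_fst hD t x).deriv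
  have h2 : deriv (fun y : ℝ => u t (y : S1)) =
      fun y => fderiv ℝ (fun p : ℝ × ℝ => u p.1 (p.2 : S1)) (t, y) (0, 1) :=
    funext fun y => (hasDerivAt_slice_snd hD t y).deriv
  have h3 := (hasDerivAt_slice_snd
    ((contDiff_one_fderiv_apply hC (0, 1)).differentiable (by norm_num)) t x).deriv
  have h := hu.equation t x
  rw [iteratedDeriv_succ, iteratedDeriv_one, h2, h3] at h
  rw [← h1]
  exact h

/-- Uniqueness: the difference of two solutions has conserved `L²` norm, which vanishes at time zero. -/
theorem IsSchrodingerSolution.unique {V : ℝ → S1 → ℝ} {u₀ : S1 → ℂ} {u w : ℝ → S1 → ℂ}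
    (hu : IsSchrodingerSolution V u₀ u) (hw : IsSchrodingerSolution V u₀ w) : w = u := by
  set Fu : ℝ × ℝ → ℂ := fun p => u p.1 (p.2 : S1) with hFu
  set Fw : ℝ × ℝ → ℂ := fun p => w p.1 (p.2 : S1) with hFw
  have hCu : ContDiff ℝ 2 Fu := hu.contDiff
  have hCw : ContDiff ℝ 2 Fw := hw.contDiff
  set F : ℝ × ℝ → ℂ := fun p => Fw p - Fu p with hF
  have hC : ContDiff ℝ 2 F := hCw.sub hCu
  set ft : ℝ × ℝ → ℂ := fun p => fderiv ℝ F p (1, 0) with hft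
  set fx : ℝ × ℝ → ℂ := fun p => fderiv ℝ F p (0, 1) with hfx
  set fxx : ℝ × ℝ → ℂ := fun p => fderiv ℝ fx p (0, 1) with hfxx
  have hCx : ContDiff ℝ 1 fx := contDiff_one_fderiv_apply hC _
  have hct : Continuous ft := (contDiff_one_fderiv_apply hC _).continuous
  have hcF : Continuous F := hC.continuous
  have hcx : Continuous fx := hCx.continuous
  have hcxx : Continuous fxx :=
    (hCx.continuous_fderiv (by norm_num)).clm_apply continuous_const
  have dsub : ∀ p v, fderiv ℝ F p v = fderiv ℝ Fw p v - fderiv ℝ Fu p v := fun p v => by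
    rw [hF, fderiv_fun_sub (hCw.differentiable (by norm_num) p)
      (hCu.differentiable (by norm_num) p)]
    rfl
  have heq : ∀ t x, Complex.I * ft (t, x) + fxx (t, x) + (V t (x : S1) : ℂ) * F (t, x) = 0 := by
    intro t x
    have h1 := hu.equation_fderiv t x
    have h2 := hw.equation_fderiv t x
    have h3 : fxx (t, x) = fderiv ℝ (fun q => fderiv ℝ Fw q (0, 1)) (t, x) (0, 1)
        - fderiv ℝ (fun q => fderiv ℝ Fu q (0, 1)) (t, x) (0, 1) := by
      have : fx = fun p => fderiv ℝ Fw p (0, 1) - fderiv ℝ Fu p (0, 1) :=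
        funext fun p => dsub p _
      rw [hfxx, this]
      dsimp only
      rw [fderiv_fun_sub ((contDiff_one_fderiv_apply hCw _).differentiable (by norm_num) _)
        ((contDiff_one_fderiv_apply hCu _).differentiable (by norm_num) _)]
      rfl
    rw [h3, hft]
    dsimp only
    rw [dsub]
    linear_combination h2 - h1
  have hperF : ∀ t x, F (t, x + 2 * Real.pi) = F (t, x) := fun t x => by
    simp only [hF, hFw, hFu, AddCircle.coe_add_period]
  have hperx : ∀ t x, fx (t, x + 2 * Real.pi) = fx (t, x) := fun t x => by
    have h : (fun p => F (p + (0, 2 * Real.pi))) = F := by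
      funext p
      obtain ⟨a, b⟩ := p
      simpa using hperF a b
    have h2 := fderiv_comp_add_right (𝕜 := ℝ) (f := F) (x := (t, x)) (0, 2 * Real.pi)
    rw [h] at h2
    simp only [hfx, h2, Prod.mk_add_mk, add_zero]
  set Nt : ℝ → ℝ → ℂ := fun t x => ft (t, x) * star (F (t, x)) + F (t, x) * star (ft (t, x))
    with hNt
  have hNtc : Continuous Nt.uncurry := by
    change Continuous fun p : ℝ × ℝ => ft p * star (F p) + F p * star (ft p)
    fun_prop
  have hdt : ∀ t x, HasDerivAt (fun τ => F (τ, x) * star (F (τ, x))) (Nt t x) t := fun t x => by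
    have h := hasDerivAt_slice_fst (hC.differentiable (by norm_num)) t x
    exact h.mul h.star
  -- Local conservation law: `∂ₜ|F|²` is the `x`-derivative of a periodic current. The potential
  -- terms cancel because `V` is real.
  have hdx : ∀ t x, HasDerivAt
      (fun y => Complex.I * (fx (t, y) * star (F (t, y)) - F (t, y) * star (fx (t, y))))
      (Nt t x) x := fun t x => by
    have h := hasDerivAt_slice_snd (hC.differentiable (by norm_num)) t x
    have h' := hasDerivAt_slice_snd (hCx.differentiable (by norm_num)) t x
    refine (((h'.mul h.star).sub (h.mul h'.star)).const_mul Complex.I).congr_deriv ?_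
    have e := heq t x
    have e1 : ft (t, x) = Complex.I * (fxx (t, x) + (V t (x : S1) : ℂ) * F (t, x)) := by
      linear_combination (-Complex.I) * e + (ft (t, x)) * Complex.I_mul_I
    change Complex.I * ((fxx (t, x) * star (F (t, x)) + fx (t, x) * star (fx (t, x)))
      - (fx (t, x) * star (fx (t, x)) + F (t, x) * star (fxx (t, x)))) = _
    simp only [hNt, e1, Complex.star_def, map_mul, map_add, Complex.conj_I, Complex.conj_ofReal]
    ring
  have hzero : ∀ t x, ∫ y in x..(x + 2 * Real.pi), Nt t y = 0 := fun t x => by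
    rw [intervalIntegral.integral_eq_sub_of_hasDerivAt (fun y _ => hdx t y)
      ((hNtc.comp (by fun_prop : Continuous fun y : ℝ => (t, y))).intervalIntegrable _ _)]
    rw [hperF, hperx, sub_self]
  have hF0 : ∀ x, F (0, x) = 0 := fun x => by
    simp only [hF, hFw, hFu, hu.initial, hw.initial, sub_self]
  have hint : ∀ t x, ∫ y in x..(x + 2 * Real.pi), F (t, y) * star (F (t, y)) = 0 := fun t x => by
    have h1 : ∀ y, F (t, y) * star (F (t, y)) = ∫ τ in (0 : ℝ)..t, Nt τ y := fun y => by
      rw [intervalIntegral.integral_eq_sub_of_hasDerivAt (fun τ _ => hdt τ y)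
        ((hNtc.comp (by fun_prop : Continuous fun τ : ℝ => (τ, y))).intervalIntegrable _ _),
        hF0, zero_mul, sub_zero]
    simp_rw [h1]
    rw [← intervalIntegral_intervalIntegral_swap]
    · simp [hzero]
    · refine (hNtc.continuousOn.integrableOn_compact
        (isCompact_uIcc.prod isCompact_uIcc)).mono_set
        (Set.prod_mono Set.uIoc_subset_uIcc Set.uIoc_subset_uIcc)
  have hFz : ∀ t x, F (t, x) = 0 := fun t x => by
    by_contra hne
    have hpos : 0 < ∫ y in x..(x + 2 * Real.pi), Complex.normSq (F (t, y)) := by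
      refine intervalIntegral.integral_pos (by linarith [Real.two_pi_pos])
        (Continuous.continuousOn (by fun_prop))
        (fun _ _ => Complex.normSq_nonneg _)
        ⟨x, ⟨le_rfl, by linarith [Real.two_pi_pos]⟩, Complex.normSq_pos.mpr hne⟩
    have h := hint t x
    simp_rw [Complex.star_def, Complex.mul_conj] at h
    rw [intervalIntegral.integral_ofReal] at h
    exact hpos.ne' (by exact_mod_cast h)
  funext t x
  induction x using QuotientAddGroup.induction_on with
  | H x => exact sub_eq_zero.mp (hFz t x)

/-! ### The explicit potential and its beating solution. -/

/-- The travelling wave `exp (i (Q x - Q² t))`. -/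
def travellingWave (Q : ℕ) (t : ℝ) (x : S1) : ℂ :=
  Complex.exp (-(Complex.I * ((Q : ℝ) ^ 2 * t : ℝ))) * fourier (Q : ℤ) x

/-- The travelling Whittaker–Hill potential `Q² (2 β cos z - β² sin² z)`, `z = Q x - Q² t`. -/
def whittakerHillPotential (Q : ℕ) (β : ℝ) (t : ℝ) (x : S1) : ℝ :=
  (Q : ℝ) ^ 2 * (2 * β * (travellingWave Q t x).re - β ^ 2 * (travellingWave Q t x).im ^ 2)

/-- The profile `exp (β cos z)`, `z = Q x - Q² t`. -/
def waveProfile (Q : ℕ) (β : ℝ) (t : ℝ) (x : S1) : ℂ :=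
  Complex.exp (β * (travellingWave Q t x).re : ℝ)

/-- The solution oscillating between the modes `0` and `Q`. -/
def beatingSolution (Q : ℕ) (β A : ℝ) (t : ℝ) (x : S1) : ℂ :=
  A * (waveProfile Q β t x * (Real.cos (β * Q ^ 2 * t) +
    Complex.I * Real.sin (β * Q ^ 2 * t) * travellingWave Q t x))

theorem travellingWave_coe (Q : ℕ) (t x : ℝ) :
    travellingWave Q t (x : S1) = Complex.exp (((Q * x - Q ^ 2 * t : ℝ) : ℂ) * Complex.I) := by
  rw [travellingWave, fourier_coe_apply, ← Complex.exp_add]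
  congr 1
  have : (Real.pi : ℂ) ≠ 0 := by exact_mod_cast Real.pi_ne_zero
  push_cast
  field_simp
  ring

theorem travellingWave_re (Q : ℕ) (t x : ℝ) :
    (travellingWave Q t (x : S1)).re = Real.cos (Q * x - Q ^ 2 * t) := by
  rw [travellingWave_coe, Complex.exp_ofReal_mul_I_re]

theorem travellingWave_im (Q : ℕ) (t x : ℝ) :
    (travellingWave Q t (x : S1)).im = Real.sin (Q * x - Q ^ 2 * t) := by
  rw [travellingWave_coe, Complex.exp_ofReal_mul_I_im]

theorem whittakerHillPotential_coe (Q : ℕ) (β t x : ℝ) :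
    whittakerHillPotential Q β t (x : S1) = (Q : ℝ) ^ 2 * (2 * β * Real.cos (Q * x - Q ^ 2 * t)
      - β ^ 2 * Real.sin (Q * x - Q ^ 2 * t) ^ 2) := by
  rw [whittakerHillPotential, travellingWave_re, travellingWave_im]

theorem beatingSolution_coe (Q : ℕ) (β A t x : ℝ) :
    beatingSolution Q β A t (x : S1) =
      A * (Complex.exp (β * Real.cos (Q * x - Q ^ 2 * t) : ℝ) * (Real.cos (β * Q ^ 2 * t) +
      Complex.I * Real.sin (β * Q ^ 2 * t) *
        Complex.exp (((Q * x - Q ^ 2 * t : ℝ) : ℂ) * Complex.I))) := by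
  rw [beatingSolution, waveProfile, travellingWave_re, travellingWave_coe]

theorem contDiff_whittakerHillPotential (Q : ℕ) (β : ℝ) :
    IsContDiffOnCylinder ∞ (whittakerHillPotential Q β) := by
  unfold IsContDiffOnCylinder
  simp_rw [whittakerHillPotential_coe]
  fun_prop

theorem analytic_whittakerHillPotential (Q : ℕ) (β t : ℝ) :
    IsAnalyticOnCircle (whittakerHillPotential Q β t) := by
  intro x _
  simp_rw [whittakerHillPotential_coe]
  fun_prop

theorem contDiff_beatingSolution (Q : ℕ) (β A : ℝ) :
    ContDiff ℝ ω (fun p : ℝ × ℝ => beatingSolution Q β A p.1 (p.2 : S1)) := by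
  simp_rw [beatingSolution_coe]
  have ofReal {f : ℝ × ℝ → ℝ} (hf : ContDiff ℝ ω f) : ContDiff ℝ ω (fun p => (f p : ℂ)) :=
    Complex.ofRealCLM.contDiff.comp hf
  have hz : ContDiff ℝ ω (fun p : ℝ × ℝ => (Q : ℝ) * p.2 - (Q : ℝ) ^ 2 * p.1) := by fun_prop
  have hω : ContDiff ℝ ω (fun p : ℝ × ℝ => β * (Q : ℝ) ^ 2 * p.1) := by fun_prop
  exact contDiff_const.mul ((ofReal (contDiff_const.mul hz.cos)).cexp.mul
    ((ofReal hω.cos).add ((contDiff_const.mul (ofReal hω.sin)).mul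
      ((ofReal hz).mul contDiff_const).cexp)))

theorem analytic_beatingSolution (Q : ℕ) (β A t : ℝ) :
    IsAnalyticOnCircle (beatingSolution Q β A t) := by
  have h : ContDiff ℝ ω (fun x : ℝ => beatingSolution Q β A t (x : S1)) :=
    ContDiff.comp (g := fun p : ℝ × ℝ => beatingSolution Q β A p.1 (p.2 : S1))
      (f := fun x : ℝ => ((t, x) : ℝ × ℝ)) (contDiff_beatingSolution Q β A)
      (contDiff_const.prodMk contDiff_id)
  exact fun x _ => h.contDiffAt.analyticAt

theorem isSchrodingerSolution_beatingSolution (Q : ℕ) (β A : ℝ) :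
    IsSchrodingerSolution (whittakerHillPotential Q β) (beatingSolution Q β A 0)
      (beatingSolution Q β A) where
  contDiff := (contDiff_beatingSolution Q β A).of_le le_top
  initial := rfl
  equation t x := by
    have hz : ∀ t x : ℝ, HasDerivAt (fun x : ℝ => (Q * x - Q ^ 2 * t : ℝ)) (Q : ℝ) x :=
      fun t x => by simpa using ((hasDerivAt_id x).const_mul (Q : ℝ)).sub_const (Q ^ 2 * t : ℝ)
    have hzt : HasDerivAt (fun t : ℝ => (Q * x - Q ^ 2 * t : ℝ)) (-(Q : ℝ) ^ 2) t := by
      simpa using ((hasDerivAt_id t).const_mul ((Q : ℝ) ^ 2)).const_sub (Q * x : ℝ)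
    have hωt : HasDerivAt (fun t : ℝ => β * Q ^ 2 * t) (β * (Q : ℝ) ^ 2) t := by
      simpa using (hasDerivAt_id t).const_mul (β * (Q : ℝ) ^ 2)
    set ω₀ : ℝ := β * Q ^ 2 * t with hω₀
    have d1 := ((((hzt.cos.const_mul β).ofReal_comp.cexp).mul
      (hωt.cos.ofReal_comp.add ((hωt.sin.ofReal_comp.const_mul Complex.I).mul
        (hzt.ofReal_comp.mul_const Complex.I).cexp))).const_mul (A : ℂ)).deriv
    have d2 : ∀ y : ℝ, HasDerivAt (fun y : ℝ => beatingSolution Q β A t (y : S1))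
        (A * (Complex.exp (β * Real.cos (Q * y - Q ^ 2 * t) : ℝ) *
          (-(β * Q * Real.sin (Q * y - Q ^ 2 * t) : ℝ) * (Real.cos ω₀ +
      Complex.I * Real.sin ω₀ * Complex.exp (((Q * y - Q ^ 2 * t : ℝ) : ℂ) * Complex.I))
        - Q * Real.sin ω₀ * Complex.exp (((Q * y - Q ^ 2 * t : ℝ) : ℂ) * Complex.I)))) y := by
      intro y
      simp_rw [beatingSolution_coe]
      refine ((((((hz t y).cos.const_mul β).ofReal_comp.cexp).mul
        ((((hz t y).ofReal_comp.mul_const Complex.I).cexp.const_mul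
          (Complex.I * Real.sin ω₀)).const_add (Real.cos ω₀ : ℂ))).const_mul (A : ℂ))).congr_deriv ?_
      push_cast
      linear_combination (A * Complex.exp (β * Complex.cos (Q * y - Q ^ 2 * t)) *
        Q * Complex.sin ω₀ * Complex.exp ((Q * y - Q ^ 2 * t) * Complex.I)) * Complex.I_mul_I
    have d3 := (((((hz t x).cos.const_mul β).ofReal_comp.cexp).mul
      ((((((hz t x).sin.const_mul (β * Q))).ofReal_comp.neg).mul
        ((((hz t x).ofReal_comp.mul_const Complex.I).cexp.const_mul
          (Complex.I * Real.sin ω₀)).const_add (Real.cos ω₀ : ℂ))).sub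
        (((hz t x).ofReal_comp.mul_const Complex.I).cexp.const_mul
          (Q * Real.sin ω₀ : ℂ)))).const_mul (A : ℂ)).deriv
    rw [iteratedDeriv_succ, iteratedDeriv_one, funext fun y => (d2 y).deriv]
    have e1 : (fun τ : ℝ => beatingSolution Q β A τ (x : S1)) = _ :=
      funext fun τ => beatingSolution_coe Q β A τ x
    rw [e1]
    erw [d1, d3]
    rw [whittakerHillPotential_coe, beatingSolution_coe, Complex.exp_mul_I]
    push_cast
    have hs := Complex.sin_sq_add_cos_sq (Q * x - Q ^ 2 * t : ℂ)
    simp only [Pi.add_apply, Pi.mul_apply, Pi.sub_apply, Pi.neg_apply]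
    rw [Complex.exp_mul_I]
    rw [hω₀]
    push_cast
    -- With the transcendental terms as atoms, the equation is a polynomial identity modulo `S² + C²
    -- = 1` and `I² = -1`.
    generalize Complex.exp (β * Complex.cos (Q * x - Q ^ 2 * t : ℂ)) = X
    generalize Complex.sin (Q * x - Q ^ 2 * t : ℂ) = S at *
    generalize Complex.cos (Q * x - Q ^ 2 * t : ℂ) = C at *
    generalize Complex.cos (β * Q ^ 2 * t : ℂ) = c
    generalize Complex.sin (β * Q ^ 2 * t : ℂ) = r
    have hI := Complex.I_sq
    generalize Complex.I = I at *
    clear d1 d2 d3 e1 hz hzt hωt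
    grind

/-! ### Mode expansion of the profile, with upper and lower bounds. -/

theorem HasSum.mul_of_summable_norm {ι κ R : Type*} [NormedRing R] [CompleteSpace R] {f : ι → R}
    {g : κ → R} {a b : R} (hf : HasSum f a) (hg : HasSum g b) (hf' : Summable fun i => ‖f i‖)
    (hg' : Summable fun i => ‖g i‖) : HasSum (fun p : ι × κ => f p.1 * g p.2) (a * b) :=
  hf.mul hg (summable_mul_of_summable_norm hf' hg')

theorem Complex.hasSum_exp_mul_exp (x y : ℂ) :
    HasSum (fun p : ℕ × ℕ => x ^ p.1 / (p.1 ! : ℂ) * (y ^ p.2 / (p.2 ! : ℂ)))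
      (Complex.exp x * Complex.exp y) := by
  have h : ∀ z : ℂ, ∃ f : ℕ → ℂ, f = (fun n : ℕ => z ^ n / (n ! : ℂ)) ∧
      HasSum f (Complex.exp z) ∧ Summable fun n => ‖f n‖ := fun z => by
    rw [Complex.exp_eq_exp_ℂ]
    exact ⟨_, rfl, NormedSpace.expSeries_div_hasSum_exp z,
      NormedSpace.norm_expSeries_div_summable z⟩
  obtain ⟨f, hf, hfs, hfn⟩ := h x
  obtain ⟨g, hg, hgs, hgn⟩ := h y
  have hfg := hfs.mul_of_summable_norm hgs hfn hgn
  rw [hf, hg] at hfg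
  exact hfg

theorem Real.hasSum_exp_mul_exp (x y : ℝ) :
    HasSum (fun p : ℕ × ℕ => x ^ p.1 / (p.1 ! : ℝ) * (y ^ p.2 / (p.2 ! : ℝ)))
      (Real.exp x * Real.exp y) := by
  have h : ∀ z : ℝ, ∃ f : ℕ → ℝ, f = (fun n : ℕ => z ^ n / (n ! : ℝ)) ∧
      HasSum f (Real.exp z) ∧ Summable fun n => ‖f n‖ := fun z => by
    rw [Real.exp_eq_exp_ℝ]
    exact ⟨_, rfl, NormedSpace.expSeries_div_hasSum_exp z,
      NormedSpace.norm_expSeries_div_summable z⟩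
  obtain ⟨f, hf, hfs, hfn⟩ := h x
  obtain ⟨g, hg, hgs, hgn⟩ := h y
  have hfg := hfs.mul_of_summable_norm hgs hfn hgn
  rw [hf, hg] at hfg
  exact hfg

/-- The phase `exp (-i Q² t)` of the travelling wave. -/
def wavePhase (Q : ℕ) (t : ℝ) : ℂ := Complex.exp (-(Complex.I * ((Q : ℝ) ^ 2 * t : ℝ)))

theorem norm_wavePhase (Q : ℕ) (t : ℝ) : ‖wavePhase Q t‖ = 1 := by
  rw [wavePhase, ← mul_neg, ← Complex.ofReal_neg, mul_comm, Complex.norm_exp_ofReal_mul_I]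

theorem travellingWave_eq (Q : ℕ) (t : ℝ) (x : S1) :
    travellingWave Q t x = wavePhase Q t * fourier (Q : ℤ) x := rfl

theorem conj_travellingWave (Q : ℕ) (t : ℝ) (x : S1) :
    conj (travellingWave Q t x) = conj (wavePhase Q t) * fourier (-Q : ℤ) x := by
  rw [travellingWave_eq, map_mul, fourier_neg]

theorem norm_travellingWave (Q : ℕ) (t : ℝ) (x : S1) : ‖travellingWave Q t x‖ = 1 := by
  rw [travellingWave_eq, norm_mul, norm_wavePhase, fourier_apply, Circle.norm_coe, one_mul]

theorem fourier_pow (n : ℤ) (a : ℕ) (x : S1) : fourier n x ^ a = fourier (a * n) x := by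
  induction a with
  | zero => simp
  | succ a ih => rw [pow_succ, ih, ← fourier_add]; push_cast; ring_nf

/-- The coefficients of the expansion of `waveProfile` in Fourier modes. -/
def profileCoeff (Q : ℕ) (β t : ℝ) (p : ℕ × ℕ) : ℂ :=
  (β / 2 * wavePhase Q t) ^ p.1 / p.1 ! * ((β / 2 * conj (wavePhase Q t)) ^ p.2 / p.2 !)

/-- Write `β cos z` as `(β/2)(e^{iz} + e^{-iz})` and multiply the two exponential series. -/
theorem waveProfile_hasSum (Q : ℕ) (β t : ℝ) (x : S1) :
    HasSum (fun p : ℕ × ℕ => profileCoeff Q β t p * fourier (((p.1 : ℤ) - p.2) * Q) x)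
      (waveProfile Q β t x) := by
  have h := Complex.hasSum_exp_mul_exp (β / 2 * travellingWave Q t x)
    (β / 2 * conj (travellingWave Q t x))
  rw [← Complex.exp_add, ← mul_add, Complex.add_conj] at h
  have e1 : waveProfile Q β t x =
      Complex.exp (β / 2 * (2 * (travellingWave Q t x).re : ℝ)) := by
    rw [waveProfile]
    congr 1
    push_cast
    ring
  rw [e1]
  convert h using 2 with p
  rw [conj_travellingWave, travellingWave_eq, profileCoeff, ← mul_assoc, ← mul_assoc, mul_pow _ (fourier _ x),
    mul_pow _ (fourier _ x), fourier_pow, fourier_pow,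
    show ((p.1 : ℤ) - p.2) * Q = p.1 * Q + p.2 * (-Q) by ring, fourier_add]
  ring

theorem norm_profileCoeff (Q : ℕ) {β : ℝ} (hβ : 0 ≤ β) (t : ℝ) (p : ℕ × ℕ) :
    ‖profileCoeff Q β t p‖ = (β / 2) ^ p.1 / p.1 ! * ((β / 2) ^ p.2 / p.2 !) := by
  simp [profileCoeff, norm_wavePhase, abs_of_nonneg hβ]

theorem summable_norm_profileCoeff (Q : ℕ) {β : ℝ} (hβ : 0 ≤ β) (t : ℝ) :
    Summable fun p => ‖profileCoeff Q β t p‖ := by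
  simp_rw [norm_profileCoeff Q hβ]
  exact (Real.hasSum_exp_mul_exp _ _).summable

/-- Bernoulli's inequality. A bound multiplicative in `a` and `b` lets the weight be absorbed into
the exponential series. -/
theorem one_add_abs_mul_le (Q a b : ℕ) :
    1 + |((((a : ℤ) - b) * Q : ℤ) : ℝ)| ≤ (1 + (Q : ℝ)) ^ (a + b) := by
  have h1 : |((((a : ℤ) - b) * Q : ℤ) : ℝ)| ≤ ((a + b : ℕ) : ℝ) * Q := by
    push_cast
    rw [abs_mul, Nat.abs_cast]
    gcongr
    rw [abs_le]
    constructor <;> linarith [(Nat.cast_nonneg a : (0 : ℝ) ≤ a), (Nat.cast_nonneg b : (0 : ℝ) ≤ b)]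
  have h2 := one_add_mul_le_pow (a := (Q : ℝ)) (by linarith [(Nat.cast_nonneg Q : (0 : ℝ) ≤ Q)])
    (a + b)
  linarith

/-- The weight replaces `β/2` by `(β/2)(1 + Q)^r` in both exponential series, whose product is the
right-hand side. -/
theorem weight_mul_fourierCoeff_waveProfile_le (Q : ℕ) {β r : ℝ} (hβ : 0 ≤ β) (hr : 0 ≤ r) (t : ℝ)
    (k : ℤ) :
    (1 + |(k : ℝ)|) ^ r * ‖fourierCoeff (waveProfile Q β t) k‖
      ≤ Real.exp (β * (1 + (Q : ℝ)) ^ r) := by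
  have h := Real.hasSum_exp_mul_exp (β / 2 * (1 + (Q : ℝ)) ^ r) (β / 2 * (1 + (Q : ℝ)) ^ r)
  rw [← Real.exp_add, ← add_mul, add_halves] at h
  refine weight_mul_norm_fourierCoeff_le (w := fun k : ℤ => (1 + |(k : ℝ)|) ^ r)
    (summable_norm_profileCoeff Q hβ t) (waveProfile_hasSum Q β t)
    (fun k => by positivity) (fun p => ?_) h k
  rw [norm_profileCoeff Q hβ]
  have h1 : (1 + |((((p.1 : ℤ) - p.2) * Q : ℤ) : ℝ)|) ^ r
      ≤ ((1 + (Q : ℝ)) ^ r) ^ p.1 * ((1 + (Q : ℝ)) ^ r) ^ p.2 := by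
    rw [← pow_add, ← Real.rpow_natCast, ← Real.rpow_mul (by positivity), mul_comm r,
      Real.rpow_mul (by positivity), Real.rpow_natCast]
    exact Real.rpow_le_rpow (by positivity) (one_add_abs_mul_le Q p.1 p.2) hr
  calc _ ≤ (((1 + (Q : ℝ)) ^ r) ^ p.1 * ((1 + (Q : ℝ)) ^ r) ^ p.2) *
        ((β / 2) ^ p.1 / p.1 ! * ((β / 2) ^ p.2 / p.2 !)) := by gcongr
    _ = _ := by
      rw [mul_pow, mul_pow]
      ring

/-- Only the diagonal pairs `(n, n)` contribute. The phases cancel there, leaving the nonnegative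
terms `((β/2)^n / n!)²`, and the one with `n = 0` is `1`. -/
theorem one_le_norm_fourierCoeff_waveProfile_zero {Q : ℕ} (hQ : 1 ≤ Q) {β : ℝ} (hβ : 0 ≤ β)
    (t : ℝ) : 1 ≤ ‖fourierCoeff (waveProfile Q β t) 0‖ := by
  have h := fourierCoeff_hasSum_of_hasSum_fourier (summable_norm_profileCoeff Q hβ t)
    (waveProfile_hasSum Q β t) 0
  have h1 := Complex.reCLM.hasSum h
  refine le_trans ?_ (Complex.re_le_norm _)
  refine le_trans (le_of_eq ?_) (le_hasSum h1 (0, 0) fun p _ => ?_)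
  · simp [profileCoeff]
  · change 0 ≤ (ite _ _ _ : ℂ).re
    split_ifs with hp
    · have hab : p.1 = p.2 := by
        rcases mul_eq_zero.mp hp with h | h <;> omega
      have : profileCoeff Q β t p = (((β / 2) ^ p.2 / p.2 !) ^ 2 : ℝ) := by
        have hphase : wavePhase Q t * conj (wavePhase Q t) = 1 := by
          rw [Complex.mul_conj, Complex.normSq_eq_norm_sq, norm_wavePhase]; simp
        rw [profileCoeff, hab, div_mul_div_comm, ← mul_pow,
          show (β / 2 * wavePhase Q t) * (β / 2 * conj (wavePhase Q t)) = (β / 2 : ℂ) ^ 2 by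
            linear_combination (β / 2 : ℂ) ^ 2 * hphase]
        push_cast
        rw [← pow_mul, div_pow _ (p.2 ! : ℂ), mul_comm 2, pow_mul, sq (p.2 ! : ℂ)]
      rw [this, Complex.ofReal_re]
      positivity
    · simp

/-! ### Uniform Gevrey bound on the potential. -/

/-- The constant `5` counts the modes `0, ±Q, ±2Q`, each of weighted size at most `1`. -/
theorem gevreySeminorm_whittakerHillPotential_le {α : ℝ} (hα : 1 ≤ α) {Q : ℕ} (hQ : 1 ≤ Q) {ε β : ℝ}
    (hε : ε = Real.exp (-((Q : ℝ) ^ (1 / α)))) (hβ : β * Q ^ 2 = ε) (t : ℝ) :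
    gevreySeminorm α 1 (fun x => (whittakerHillPotential Q β t x : ℂ)) ≤ ENNReal.ofReal 5 := by
  have hQ' : (1 : ℝ) ≤ Q := by exact_mod_cast hQ
  have hε0 : 0 < ε := hε ▸ Real.exp_pos _
  have hε1 : ε ≤ 1 := by
    rw [hε, Real.exp_le_one_iff]
    linarith [Real.rpow_nonneg (zero_le_one.trans hQ') (1 / α)]
  have hβ0 : 0 < β := by
    have : 0 < β * (Q : ℝ) ^ 2 := hβ ▸ hε0
    exact pos_of_mul_pos_left this (by positivity)
  have hβε : β ≤ ε := by
    rw [← hβ]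
    exact le_mul_of_one_le_right hβ0.le (one_le_pow₀ hQ')
  set ph := wavePhase Q t with hph
  have hn : ‖ph‖ = 1 := norm_wavePhase Q t
  set c : Fin 5 → ℂ := ![ε * ph, ε * conj ph, -(ε * β / 2), ε * β / 4 * ph ^ 2,
    ε * β / 4 * conj ph ^ 2] with hc
  set κ : Fin 5 → ℤ := ![Q, -Q, 0, 2 * Q, 2 * -Q] with hκ
  have hsum : ∀ x, HasSum (fun i => c i * fourier (κ i) x)
      ((whittakerHillPotential Q β t x : ℂ)) := fun x => by
    convert hasSum_fintype (fun i => c i * fourier (κ i) x) using 1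
    rw [Fin.sum_univ_five]
    simp only [hc, hκ, Matrix.cons_val]
    have e2 : fourier (2 * Q : ℤ) x = fourier (Q : ℤ) x ^ 2 := by rw [fourier_pow]; rfl
    have e3 : fourier (2 * -Q : ℤ) x = fourier (-Q : ℤ) x ^ 2 := by rw [fourier_pow]; rfl
    rw [e2, e3, fourier_zero]
    have hE := travellingWave_eq Q t x
    have hE' := conj_travellingWave Q t x
    have hEE : travellingWave Q t x * conj (travellingWave Q t x) = 1 := by
      rw [Complex.mul_conj, Complex.normSq_eq_norm_sq, norm_travellingWave]; simp
    have hre := Complex.add_conj (travellingWave Q t x)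
    have him := Complex.sub_conj (travellingWave Q t x)
    rw [whittakerHillPotential]
    rw [← hph] at hE hE'
    have hβC : (β : ℂ) * Q ^ 2 = ε := by exact_mod_cast hβ
    have hI := Complex.I_sq
    push_cast at hre him ⊢
    generalize travellingWave Q t x = E at *
    generalize conj E = E' at *
    generalize (E.re : ℂ) = R at *
    generalize (E.im : ℂ) = S at *
    have hS : S ^ 2 = (2 - E ^ 2 - E' ^ 2) / 4 := by
      linear_combination (1 / 4 : ℂ) * (E - E' + 2 * S * Complex.I) * him + S ^ 2 * hI
        + (1 / 2 : ℂ) * hEE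
    have hR : R = (E + E') / 2 := by linear_combination (-1 / 2 : ℂ) * hre
    rw [hS, hR, ← hβC, hE, hE']
    ring
  have hexp : ε * Real.exp ((Q : ℝ) ^ (1 / α)) = 1 := by
    rw [hε, ← Real.exp_add]; simp
  have hα0 : 0 < 1 / α := by positivity
  -- As `1/α ≤ 1`, the weight at `2Q` is at most the square of the weight at `Q`, and the quadratic
  -- amplitude `εβ/4 ≤ ε²` compensates for it.
  have h2 : (2 * (Q : ℝ)) ^ (1 / α) ≤ (Q : ℝ) ^ (1 / α) + (Q : ℝ) ^ (1 / α) := by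
    rw [Real.mul_rpow (by norm_num) (by positivity), ← two_mul]
    gcongr
    calc (2 : ℝ) ^ (1 / α) ≤ 2 ^ (1 : ℝ) :=
          Real.rpow_le_rpow_of_exponent_le (by norm_num) ((div_le_one (by linarith)).mpr hα)
      _ = 2 := Real.rpow_one 2
  have hexp2 : Real.exp ((2 * (Q : ℝ)) ^ (1 / α)) * (ε * β / 4) ≤ 1 := by
    calc _ ≤ Real.exp ((Q : ℝ) ^ (1 / α) + (Q : ℝ) ^ (1 / α)) * (ε * ε / 1) := by
          gcongr
          norm_num
      _ = (ε * Real.exp ((Q : ℝ) ^ (1 / α))) ^ 2 := by rw [Real.exp_add]; ring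
      _ ≤ 1 := by rw [hexp]; norm_num
  refine iSup_le fun k => ENNReal.ofReal_le_ofReal ?_
  rw [mul_comm]
  refine weight_mul_norm_fourierCoeff_le
    (w := fun k : ℤ => Real.exp (1 * |(k : ℝ)| ^ (1 / α))) (b := fun _ : Fin 5 => (1 : ℝ))
    (Summable.of_finite) hsum (fun k => (Real.exp_pos _).le) (fun i => ?_) ?_ k
  · fin_cases i
    · simp [hc, hκ, hn, abs_of_pos hε0]
      rw [mul_comm]; simpa using hexp.le
    · simp [hc, hκ, hn, abs_of_pos hε0]
      rw [mul_comm]; simpa using hexp.le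
    · simp [hc, hκ, abs_of_pos hε0, abs_of_pos hβ0, Real.zero_rpow (by positivity : α⁻¹ ≠ 0)]
      nlinarith
    · simp [hc, hκ, hn, abs_of_pos hε0, abs_of_pos hβ0]
      simpa using hexp2
    · simp [hc, hκ, hn, abs_of_pos hε0, abs_of_pos hβ0]
      simpa using hexp2
  · convert hasSum_fintype (fun _ : Fin 5 => (1 : ℝ)) using 1
    norm_num

/-! ### Sobolev size at time zero and at the half period. -/

/-- In the variable `y = Q^{1/α}` the power is at most a multiple of `y^n` with `n ≥ αr`, and `y^n ≤
n! e^y`. This keeps the exponent `β(1 + Q)^r` of the profile bound uniform in `Q`. -/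
theorem exists_bound_exp_neg_rpow_mul_rpow {α : ℝ} (hα : 1 ≤ α) {r : ℝ} (hr : 0 ≤ r) :
    ∃ L : ℝ, ∀ Q : ℝ, 1 ≤ Q → Real.exp (-(Q ^ (1 / α))) * (1 + Q) ^ r ≤ L := by
  obtain ⟨n, hn⟩ := exists_nat_ge (α * r)
  refine ⟨2 ^ r * n !, fun Q hQ => ?_⟩
  have hQ0 : 0 < Q := by linarith
  have hα0 : 0 < α := by linarith
  set y := Q ^ (1 / α) with hy
  have hy1 : 1 ≤ y := Real.one_le_rpow hQ (by positivity)
  have hQy : Q = y ^ α := by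
    rw [hy, ← Real.rpow_mul hQ0.le, one_div_mul_cancel hα0.ne', Real.rpow_one]
  have h1 : (1 + Q) ^ r ≤ 2 ^ r * y ^ n := by
    calc (1 + Q) ^ r ≤ (2 * Q) ^ r := Real.rpow_le_rpow (by positivity) (by linarith) hr
      _ = 2 ^ r * y ^ (α * r) := by
        rw [Real.mul_rpow (by norm_num) hQ0.le, hQy, ← Real.rpow_mul (by positivity)]
      _ ≤ 2 ^ r * y ^ (n : ℝ) := by gcongr
      _ = 2 ^ r * y ^ n := by rw [Real.rpow_natCast]
  have h2 : y ^ n ≤ Real.exp y * n ! := by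
    have := Real.pow_div_factorial_le_exp y (by linarith) n
    rwa [div_le_iff₀ (by positivity)] at this
  calc Real.exp (-y) * (1 + Q) ^ r ≤ Real.exp (-y) * (2 ^ r * (Real.exp y * n !)) := by
        gcongr
        exact h1.trans (by gcongr)
    _ = (Real.exp (-y) * Real.exp y) * (2 ^ r * n !) := by ring
    _ = 2 ^ r * n ! := by rw [← Real.exp_add]; simp

theorem beatingSolution_zero (Q : ℕ) (β A : ℝ) :
    beatingSolution Q β A 0 = fun x => (A : ℂ) * waveProfile Q β 0 x := by
  funext x
  simp [beatingSolution]

theorem beatingSolution_half_period {Q : ℕ} {β A T : ℝ} (hT : β * Q ^ 2 * T = Real.pi / 2) :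
    beatingSolution Q β A T = fun x =>
      (A * (Complex.I * wavePhase Q T)) * (fourier (Q : ℤ) x * waveProfile Q β T x) := by
  funext x
  rw [beatingSolution, hT, Real.cos_pi_div_two, Real.sin_pi_div_two, travellingWave_eq]
  push_cast
  ring

theorem le_sobolevNorm_beatingSolution_half_period {Q : ℕ} (hQ : 1 ≤ Q) {β A T s : ℝ} (hβ : 0 ≤ β)
    (hA : 0 ≤ A) (hs : 0 < s) (hT : β * Q ^ 2 * T = Real.pi / 2) :
    A * (Q : ℝ) ^ s ≤ sobolevNorm s (beatingSolution Q β A T) := by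
  rw [beatingSolution_half_period hT, sobolevNorm_const_mul]
  have hn : ‖(A : ℂ) * (Complex.I * wavePhase Q T)‖ = A := by
    simp [norm_wavePhase, abs_of_nonneg hA]
  rw [hn]
  refine mul_le_mul_of_nonneg_left ?_ hA
  -- Needed only for convergence of the norm series, so growth in `Q` is harmless.
  have hM : ∀ k : ℤ, (1 + |(k : ℝ)|) ^ (s + 1) *
      ‖fourierCoeff (fun x => fourier (Q : ℤ) x * waveProfile Q β T x) k‖
      ≤ (1 + (Q : ℝ)) ^ (s + 1) * Real.exp (β * (1 + (Q : ℝ)) ^ (s + 1)) := fun k => by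
    rw [fourierCoeff_fourier_mul]
    have h := weight_mul_fourierCoeff_waveProfile_le Q hβ (by linarith : 0 ≤ s + 1) T (k - Q)
    refine le_trans ?_ (mul_le_mul_of_nonneg_left h (by positivity))
    rw [← mul_assoc, ← Real.mul_rpow (by positivity) (by positivity)]
    gcongr
    have h1 : |(k : ℝ)| ≤ |((k - Q : ℤ) : ℝ)| + Q := by
      have := abs_add_le ((k : ℝ) - Q) Q
      push_cast
      simpa using this
    nlinarith [abs_nonneg ((k - Q : ℤ) : ℝ), (Nat.cast_nonneg Q : (0 : ℝ) ≤ Q)]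
  refine le_trans ?_ (le_sobolevNorm hs hM (Q : ℤ))
  rw [fourierCoeff_fourier_mul, sub_self]
  have h1 : (Q : ℝ) ^ s ≤ √((1 + ((Q : ℤ) : ℝ) ^ 2) ^ s) := by
    refine Real.le_sqrt_of_sq_le ?_
    rw [← Real.rpow_natCast, ← Real.rpow_mul (by positivity), mul_comm s, Real.rpow_mul (by positivity)]
    refine Real.rpow_le_rpow (by positivity) ?_ hs.le
    norm_num
  calc (Q : ℝ) ^ s = (Q : ℝ) ^ s * 1 := (mul_one _).symm
    _ ≤ _ := mul_le_mul h1 (one_le_norm_fourierCoeff_waveProfile_zero hQ hβ T) zero_le_one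
      (Real.sqrt_nonneg _)

end

/-! ### Choice of parameters and conclusion. -/

theorem theorem2 (α : ℝ) (hα : 1 ≤ α) :
    ∃ B Cα : ℝ, 0 < B ∧ 0 < Cα ∧
      ∀ s : ℝ, 0 < s →
        ∃ (V : ℕ → ℝ → S1 → ℝ) (u₀ : ℕ → S1 → ℂ) (T : ℕ → ℝ) (Cαs : ℝ),
          0 < Cαs ∧
          (∀ q, 1 < T q) ∧
          Filter.Tendsto T Filter.atTop Filter.atTop ∧
          (∀ q, IsContDiffOnCylinder ∞ (V q)) ∧
          (∀ q t, IsAnalyticOnCircle (V q t)) ∧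
          (∀ q, ∀ t ∈ Set.Icc 0 (T q),
            gevreySeminorm α B (fun x => (V q t x : ℂ)) ≤ ENNReal.ofReal Cα) ∧
          (∀ q, sobolevNorm s (u₀ q) = 1) ∧
          ∀ q, ∃ u : ℝ → S1 → ℂ,
            IsSchrodingerSolution (V q) (u₀ q) u ∧
            (∀ w : ℝ → S1 → ℂ, IsSchrodingerSolution (V q) (u₀ q) w → w = u) ∧
            (∀ t ∈ Set.Icc 0 (T q), IsAnalyticOnCircle (u t)) ∧
            Cαs * Real.log (T q) ^ (s * α) ≤ sobolevNorm s (u (T q)) := by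
  refine ⟨1, 5, one_pos, by norm_num, fun s hs => ?_⟩
  have hα0 : 0 < α := by linarith
  obtain ⟨L, hL⟩ := exists_bound_exp_neg_rpow_mul_rpow hα (by linarith : 0 ≤ s + 1)
  set Q : ℕ → ℕ := fun q => q + 1 with hQ
  have hQ1 : ∀ q, 1 ≤ Q q := fun q => Nat.succ_pos q
  have hQR : ∀ q, (1 : ℝ) ≤ Q q := fun q => by exact_mod_cast hQ1 q
  set ε : ℕ → ℝ := fun q => Real.exp (-((Q q : ℝ) ^ (1 / α))) with hε
  set β : ℕ → ℝ := fun q => ε q / (Q q : ℝ) ^ 2 with hβ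
  set N : ℕ → ℝ := fun q => sobolevNorm s (waveProfile (Q q) (β q) 0) with hN
  set T : ℕ → ℝ := fun q => Real.pi / 2 * Real.exp ((Q q : ℝ) ^ (1 / α)) with hT
  -- A bound for all normalising constants `N q`; it depends only on `α` and `s`.
  set K : ℝ := Real.exp L * √(∑' k : ℤ, ((1 + |(k : ℝ)|) ^ 2)⁻¹) with hK
  have hε0 : ∀ q, 0 < ε q := fun q => Real.exp_pos _
  have hβ0 : ∀ q, 0 < β q := fun q => div_pos (hε0 q) (by have := hQR q; positivity)
  have hβQ : ∀ q, β q * (Q q : ℝ) ^ 2 = ε q := fun q =>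
    div_mul_cancel₀ _ (by have := hQR q; positivity)
  have hβε : ∀ q, β q ≤ ε q := fun q => div_le_self (hε0 q).le (one_le_pow₀ (hQR q))
  have hM : ∀ q, ∀ k : ℤ, (1 + |(k : ℝ)|) ^ (s + 1) *
      ‖fourierCoeff (waveProfile (Q q) (β q) 0) k‖ ≤ Real.exp L := fun q k => by
    refine (weight_mul_fourierCoeff_waveProfile_le (Q q) (hβ0 q).le (by linarith) 0 k).trans ?_
    refine Real.exp_le_exp.mpr (le_trans ?_ (hL (Q q) (hQR q)))
    have := hβε q
    gcongr
  have hNK : ∀ q, N q ≤ K := fun q => sobolevNorm_le hs (hM q)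
  have hN1 : ∀ q, 1 ≤ N q := fun q => by
    refine (one_le_norm_fourierCoeff_waveProfile_zero (hQ1 q) (hβ0 q).le 0).trans ?_
    simpa using le_sobolevNorm hs (hM q) 0
  have hK1 : 1 ≤ K := (hN1 0).trans (hNK 0)
  have hy1 : ∀ q, 1 ≤ (Q q : ℝ) ^ (1 / α) := fun q => Real.one_le_rpow (hQR q) (by positivity)
  have hπ : 1 < Real.pi / 2 := by linarith [Real.pi_gt_three]
  have hπ0 : (0 : ℝ) < Real.pi / 2 := by linarith
  -- In `(K * 2 ^ (s * α))⁻¹`, the factor `K` pays for normalising the data and `2 ^ (s * α)` comes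
  -- from `log T ≤ 2 Q^{1/α}`.
  refine ⟨fun q => whittakerHillPotential (Q q) (β q),
    fun q => beatingSolution (Q q) (β q) (N q)⁻¹ 0, T, (K * 2 ^ (s * α))⁻¹, by positivity,
    fun q => ?_, ?_, fun q => contDiff_whittakerHillPotential _ _,
    fun q t => analytic_whittakerHillPotential _ _ t,
    fun q t _ => gevreySeminorm_whittakerHillPotential_le hα (hQ1 q) rfl (hβQ q) t,
    fun q => ?_, fun q => ⟨beatingSolution (Q q) (β q) (N q)⁻¹,
      isSchrodingerSolution_beatingSolution _ _ _,
      fun w hw => (isSchrodingerSolution_beatingSolution _ _ _).unique hw,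
      fun t _ => analytic_beatingSolution _ _ _ t, ?_⟩⟩
  · exact one_lt_mul_of_lt_of_le hπ (Real.one_le_exp (by linarith [hy1 q]))
  · refine Filter.Tendsto.const_mul_atTop hπ0 (Real.tendsto_exp_atTop.comp
      ((tendsto_rpow_atTop (by positivity)).comp ?_))
    exact tendsto_natCast_atTop_atTop.comp (Filter.tendsto_add_atTop_nat 1)
  · beta_reduce
    rw [beatingSolution_zero, sobolevNorm_const_mul, Complex.norm_real,
      Real.norm_of_nonneg (inv_nonneg.mpr (by linarith [hN1 q]))]
    exact inv_mul_cancel₀ (by linarith [hN1 q])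
  · have hTq : β q * (Q q : ℝ) ^ 2 * T q = Real.pi / 2 := by
      rw [hβQ, hT, hε]
      dsimp only
      rw [mul_left_comm, ← Real.exp_add, neg_add_cancel, Real.exp_zero, mul_one]
    refine le_trans ?_ (le_sobolevNorm_beatingSolution_half_period (hQ1 q) (hβ0 q).le
      (inv_nonneg.mpr (by linarith [hN1 q])) hs hTq)
    have hlog : Real.log (T q) ≤ 2 * (Q q : ℝ) ^ (1 / α) := by
      rw [hT]
      dsimp only
      rw [Real.log_mul hπ0.ne' (Real.exp_pos _).ne', Real.log_exp]
      -- `log (π/2) ≤ π/2 - 1 < 1 ≤ Q^{1/α}`, whence the factor `2`.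
      linarith [Real.log_le_sub_one_of_pos hπ0, Real.pi_lt_four, hy1 q]
    have hlog0 : 0 ≤ Real.log (T q) :=
      Real.log_nonneg (one_lt_mul_of_lt_of_le hπ (Real.one_le_exp (by linarith [hy1 q]))).le
    have hpow : Real.log (T q) ^ (s * α) ≤ 2 ^ (s * α) * (Q q : ℝ) ^ s := by
      calc _ ≤ (2 * (Q q : ℝ) ^ (1 / α)) ^ (s * α) :=
            Real.rpow_le_rpow hlog0 hlog (by positivity)
        _ = _ := by
          rw [Real.mul_rpow (by norm_num) (by positivity), ← Real.rpow_mul (by positivity),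
            show 1 / α * (s * α) = s by field_simp]
    calc (K * 2 ^ (s * α))⁻¹ * Real.log (T q) ^ (s * α)
        ≤ (K * 2 ^ (s * α))⁻¹ * (2 ^ (s * α) * (Q q : ℝ) ^ s) := by gcongr
      _ = K⁻¹ * (Q q : ℝ) ^ s := by
        have : (2 : ℝ) ^ (s * α) ≠ 0 := by positivity
        field_simp
      _ ≤ (N q)⁻¹ * (Q q : ℝ) ^ s := by
        have := hNK q
        have := hN1 q
        gcongr
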